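/- Theorem 1 (Distribution-Dependent Lower Bound). Let $n \ge 3$ and let $P = (p_{i,j}) \in [0,1]^{n\times n}$ be a preference matrix on $n$ arms: whenever arms $i$ and $j$ are dueled, arm $i$ wins with probability $p_{i,j}$ and arm $j$ wins with probability $p_{j,i} = 1 - p_{i,j}$, independently of the past. The Borda score of arm $i$ is $s_i = \frac{1}{n-1}\sum_{j \ne i} p_{i,j}$. Suppose that $\frac38 \le p_{i,j} \le \frac58$ for all $i, j \in [n]$, and that $P$ has a unique Borda winner, which is called arm $1$: $s_1 > s_i$ for all $i \ne 1$ (the algorithm does not know which arm this is). A dueling bandits algorithm sequentially selects pairs of arms to duel, possibly at random and depending on the outcomes of the earlier duels; it may stop at any time, and it then declares one arm. It is $\delta$-PAC if, for every preference matrix with entries in $[0,1]$ that has a unique Borda winner, with probability at least $1-\delta$ it stops and declares that winner. Let $\tau \in [0,\infty]$ be its total number of duels, and let $\mathbb{E}_P$ be the expectation when the preference matrix is $P$. Then for every $0 < \delta \le 0.15$ and every $\delta$-PAC dueling bandits algorithm, $$\mathbb{E}_P[\tau] \ \ge\ \frac{1}{40}\Big(\frac{n-2}{n-1}\Big)^2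 \Big(\sum_{i \ne 1} \frac{1}{(s_1-s_i)^2}\Big)\log\frac{1}{2\delta},$$ and, if $n \ge 4$, $$\mathbb{E}_P[\tau] \ \ge\ \frac{1}{90}\,\log\frac{1}{2\delta}\,\sum_{i \ne 1} \frac{1}{(s_1-s_i)^2}.$$ -/

import Mathlib

open MeasureTheory

/-- The preference matrices on `n` arms: `P i j` is the probability that arm `i` wins a duel against
arm `j`, and `P j i = 1 - P i j` (in particular `P i i = 1 / 2`). -/
structure IsPreferenceMatrix {n : ℕ} (P : Matrix (Fin n) (Fin n) ℝ) : Prop where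
  nonneg : ∀ i j, 0 ≤ P i j
  le_one : ∀ i j, P i j ≤ 1
  add_swap : ∀ i j, P i j + P j i = 1

/-- The Borda score of arm `i`: the probability that `i` wins a duel against another arm that is
chosen uniformly at random. -/
noncomputable def bordaScore {n : ℕ} (P : Matrix (Fin n) (Fin n) ℝ) (i : Fin n) : ℝ :=
  (1 / ((n : ℝ) - 1)) * ∑ j ∈ Finset.univ.erase i, P i j

/-- `b` is the unique Borda winner of `P`. -/
def IsUniqueBordaWinner {n : ℕ} (P : Matrix (Fin n) (Fin n) ℝ) (b : Fin n) : Prop :=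
  ∀ i, i ≠ b → bordaScore P i < bordaScore P b

/-- What an algorithm can do next: duel the arms `i` and `j`, or stop and declare that arm `b` is
the Borda winner. -/
inductive DuelingAction (n : ℕ) where
  | duel (i j : Fin n) : DuelingAction n
  | declare (b : Fin n) : DuelingAction n

/-- A list of the duels made so far, in chronological order: the entry `(i, j, x)` records a duel
between `i` and `j`, and `x = true` means that `i` won. -/
abbrev History (n : ℕ) : Type := List (Fin n × Fin n × Bool)

/-- A (randomized, adaptive, sequential) dueling bandits algorithm on `n` arms. It draws a seed from
an arbitrary probability space, which is its internal randomness, and then chooses each action from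
the seed and the outcomes of the duels seen so far. It does not depend on the preference matrix. -/
structure DuelingAlgorithm.{u} (n : ℕ) where
  /-- The space of internal randomness. -/
  Seed : Type u
  [measurableSpace : MeasurableSpace Seed]
  /-- The law of the internal randomness. -/
  seedLaw : Measure Seed
  [isProbabilityMeasure : IsProbabilityMeasure seedLaw]
  /-- The next action. -/
  act : Seed → History n → DuelingAction n
  measurableSet_act : ∀ (h : History n) (a : DuelingAction n), MeasurableSet {u | act u h = a}

attribute [instance] DuelingAlgorithm.measurableSpace DuelingAlgorithm.isProbabilityMeasure

namespace DuelingAlgorithm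

variable {n : ℕ} (alg : DuelingAlgorithm n)

/-- The sample space: the seed of the algorithm, and for each round a number in `[0, 1]` that
decides the outcome of the duel of that round. -/
abbrev Sample : Type _ := alg.Seed × (ℕ → unitInterval)

/-- The seed has its own law, and independently of it the numbers that decide the duels are
independent and uniform on `[0, 1]`. -/
noncomputable def law : Measure alg.Sample :=
  alg.seedLaw.prod (Measure.infinitePi fun _ : ℕ => (volume : Measure unitInterval))

/-- The duels made in the first `t` rounds under the preference matrix `P`. If the arms `i` and `j`
are dueled in round `t`, then `i` wins exactly if the uniform number of this round is less than
`P i j`: given the past, this has probability `P i j`. Once the algorithm has stopped, nothing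
changes any more. -/
noncomputable def history (P : Matrix (Fin n) (Fin n) ℝ) (ω : alg.Sample) : ℕ → History n
  | 0 => []
  | t + 1 =>
    match alg.act ω.1 (history P ω t) with
    | .duel i j => history P ω t ++ [(i, j, if (ω.2 t : ℝ) < P i j then true else false)]
    | .declare _ => history P ω t

/-- The total number `τ` of duels (infinite if the algorithm never stops). -/
noncomputable def numDuels (P : Matrix (Fin n) (Fin n) ℝ) (ω : alg.Sample) : ENNReal :=
  ⨆ t : ℕ, ((alg.history P ω t).length : ENNReal)

/-- The expected total number `𝔼_P[τ]` of duels. -/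
noncomputable def expectedDuels (P : Matrix (Fin n) (Fin n) ℝ) : ENNReal :=
  ∫⁻ ω, alg.numDuels P ω ∂alg.law

/-- The event that the algorithm stops after finitely many duels and declares arm `b`. -/
def outputs (P : Matrix (Fin n) (Fin n) ℝ) (b : Fin n) : Set alg.Sample :=
  {ω | ∃ t : ℕ, alg.act ω.1 (alg.history P ω t) = DuelingAction.declare b}

/-- `δ`-PAC: whatever the preference matrix with a unique Borda winner is, the algorithm stops and
declares that winner with probability at least `1 - δ`. -/
def IsPAC (δ : ℝ) : Prop :=
  ∀ (P : Matrix (Fin n) (Fin n) ℝ) (b : Fin n), IsPreferenceMatrix P → IsUniqueBordaWinner P b →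
    1 - δ ≤ alg.law.real (alg.outputs P b)

end DuelingAlgorithm

/-!
The proof is a change-of-measure argument, carried out at finite horizons. For each arm `i` other than
the winner `best`, let `Q i` be the preference matrix `raiseArm P best i D` in which arm `i` does
better by `D`, slightly more than `(n - 1) / (n - 2)` times the gap `s_best - s_i`, against every arm
except `best`. Then `i` is the winner of `Q i` (`isUniqueBordaWinner_raiseArm`), so a `δ`-PAC algorithm
declares `best` with probability at least `1 - δ` under `P` and at most `δ` under `Q i`.

To tell `P` from `Q i` the algorithm has to collect information. The history of the duels is a Markov
process given the seed (`integral_history_succ`), hence expectations under `Q` are expectations under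
`P` weighted by the likelihood ratio (`integral_history_eq_integral_mul_exp`), and the expected
log-likelihood ratio under `P` is at least minus the expected sum of the `χ²`-divergences of the duels
(`integral_logLikelihoodRatio_add_nonneg`). The convexity inequality `x ≤ exp x / y - 1 + log y` turns
this into the transportation inequality `mul_declaredBy_sub_le_log`. With the best choice of its
parameter, and as the horizon tends to infinity, the expected total divergence from `P` to `Q i` is at
least `(1 - 2δ) log ((1 - δ) / δ)`, which for `δ ≤ 0.15` is at least `(7 / 10) log (1 / (2δ))`.

Since the entries of `Q i` lie in `[3/25, 22/25]` (`raiseArm_overtakingRaise_mem`), a duel has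
divergence at most `10 D ^ 2`, and only duels of arm `i` have any. Weighting the inequality of arm `i` by
`1 / D ^ 2` and summing over `i`, every duel is counted at most twice, so it contributes at most `20`
(`sum_mul_log_le_mul_expectedDuels` with `K = 20`). The bound with the constant `1 / 90` follows from
the other one, because `(n - 2) / (n - 1) ≥ 2 / 3` for `n ≥ 4`.
-/

/-! ### The history as a Markov process -/

namespace DuelingAlgorithm

open ProbabilityTheory

variable {n : ℕ}

/-- Histories carry the discrete σ-algebra. -/
instance instMeasurableSpaceHistory : MeasurableSpace (History n) := ⊤

instance instDiscreteMeasurableSpaceHistory : DiscreteMeasurableSpace (History n) :=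
  ⟨fun _ => trivial⟩

/-- Actions carry the discrete σ-algebra. -/
instance instMeasurableSpaceAction : MeasurableSpace (DuelingAction n) := ⊤

instance instDiscreteMeasurableSpaceAction : DiscreteMeasurableSpace (DuelingAction n) :=
  ⟨fun _ => trivial⟩

instance instCountableAction : Countable (DuelingAction n) := by
  let f : DuelingAction n → (Fin n × Fin n) ⊕ Fin n := fun a =>
    match a with
    | .duel i j => .inl (i, j)
    | .declare b => .inr b
  refine Function.Injective.countable (f := f) ?_
  rintro (⟨i, j⟩ | b) (⟨k, l⟩ | c) h <;> simp_all [f]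

/-- The history after action `a` is taken at history `h`, when the uniform number of the round
is `z`. -/
noncomputable def next (P : Matrix (Fin n) (Fin n) ℝ) (a : DuelingAction n) (h : History n)
    (z : unitInterval) : History n :=
  match a with
  | .duel i j => h ++ [(i, j, if (z : ℝ) < P i j then true else false)]
  | .declare _ => h

/-- The conditional expectation of `G` of the next history, given that action `a` is taken at
history `h`. -/
def nextMean (P : Matrix (Fin n) (Fin n) ℝ) (a : DuelingAction n) (G : History n → ℝ)
    (h : History n) : ℝ :=
  match a with
  | .duel i j => P i j * G (h ++ [(i, j, true)]) + (1 - P i j) * G (h ++ [(i, j, false)])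
  | .declare _ => G h

lemma measurable_next (P : Matrix (Fin n) (Fin n) ℝ) (a : DuelingAction n) (h : History n) :
    Measurable (next P a h) := by
  rcases a with ⟨i, j⟩ | b
  · have : Measurable fun z : unitInterval => (if (z : ℝ) < P i j then true else false) :=
      Measurable.ite (measurableSet_lt measurable_subtype_coe measurable_const)
        measurable_const measurable_const
    exact (Measurable.of_discrete (f := fun x : Bool => h ++ [(i, j, x)])).comp this
  · exact measurable_const

lemma volume_real_lt {p : ℝ} (h0 : 0 ≤ p) (h1 : p ≤ 1) :
    (volume : Measure unitInterval).real {z | (z : ℝ) < p} = p := by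
  have : {z : unitInterval | (z : ℝ) < p} = Set.Iio ⟨p, h0, h1⟩ := by
    ext z; simp [← Subtype.coe_lt_coe]
  rw [this, Measure.real, unitInterval.volume_Iio]
  simp [h0]

lemma integral_next {P : Matrix (Fin n) (Fin n) ℝ} (hP : IsPreferenceMatrix P)
    (a : DuelingAction n) (G : History n → ℝ) (h : History n) :
    ∫ z, G (next P a h z) = nextMean P a G h := by
  rcases a with ⟨i, j⟩ | b
  · have hm : MeasurableSet {z : unitInterval | (z : ℝ) < P i j} :=
      measurableSet_lt measurable_subtype_coe measurable_const
    have : (fun z => G (next P (.duel i j) h z)) = fun z =>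
        {z : unitInterval | (z : ℝ) < P i j}.indicator (fun _ => G (h ++ [(i, j, true)])) z +
        {z : unitInterval | (z : ℝ) < P i j}ᶜ.indicator (fun _ => G (h ++ [(i, j, false)])) z := by
      ext z
      by_cases hz : (z : ℝ) < P i j <;> simp [next, hz]
    rw [this, integral_add ((integrable_const _).indicator hm)
      ((integrable_const _).indicator hm.compl), integral_indicator_const _ hm,
      integral_indicator_const _ hm.compl, probReal_compl_eq_one_sub hm,
      volume_real_lt (hP.nonneg i j) (hP.le_one i j)]
    simp [nextMean]
  · simp [next, nextMean]

variable (alg : DuelingAlgorithm n) (P : Matrix (Fin n) (Fin n) ℝ)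

instance : IsProbabilityMeasure alg.law := by
  unfold law; infer_instance

lemma history_succ (ω : alg.Sample) (t : ℕ) :
    alg.history P ω (t + 1) = next P (alg.act ω.1 (alg.history P ω t)) (alg.history P ω t)
      (ω.2 t) := by
  rw [history]
  cases alg.act ω.1 (alg.history P ω t) <;> rfl

lemma length_history_le (ω : alg.Sample) (t : ℕ) : (alg.history P ω t).length ≤ t := by
  induction t with
  | zero => simp [history]
  | succ t ih =>
    rw [history_succ]
    cases alg.act ω.1 (alg.history P ω t) <;> simp [next] <;> omega

lemma measurable_act (h : History n) : Measurable fun u => alg.act u h :=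
  measurable_to_countable' fun a => alg.measurableSet_act h a

lemma measurable_history (t : ℕ) : Measurable fun ω : alg.Sample => alg.history P ω t := by
  induction t with
  | zero => exact measurable_const
  | succ t ih =>
    simp only [history_succ]
    have h1 : Measurable fun p : (alg.Seed × unitInterval) × History n =>
        next P (alg.act p.1.1 p.2) p.2 p.1.2 := by
      refine measurable_from_prod_countable_left fun h => ?_
      have h2 : Measurable fun p : unitInterval × DuelingAction n => next P p.2 h p.1 :=
        measurable_from_prod_countable_left fun a => measurable_next P a h
      exact h2.comp (measurable_snd.prodMk ((alg.measurable_act h).comp measurable_fst))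
    exact h1.comp ((measurable_fst.prodMk ((measurable_pi_apply t).comp measurable_snd)).prodMk ih)

/-- The history of the first `t` rounds only depends on the uniform numbers of these rounds. -/
lemma history_congr (u : alg.Seed) {x y : ℕ → unitInterval} {t : ℕ} (h : ∀ s < t, x s = y s) :
    alg.history P (u, x) t = alg.history P (u, y) t := by
  induction t with
  | zero => rfl
  | succ t ih =>
    rw [history_succ, history_succ, ih fun s hs => h s (by omega)]
    simp [h t (by omega)]

lemma indepFun_history (u : alg.Seed) (t : ℕ) :
    IndepFun (fun x : ℕ → unitInterval => alg.history P (u, x) t) (fun x => x t)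
      (Measure.infinitePi fun _ : ℕ => (volume : Measure unitInterval)) := by
  have hi : iIndepFun (fun (i : ℕ) (x : ℕ → unitInterval) => x i)
      (Measure.infinitePi fun _ : ℕ => (volume : Measure unitInterval)) :=
    iIndepFun_infinitePi (X := fun _ z => z) fun _ => measurable_id
  have := hi.indepFun_finset (Finset.range t) {t} (by simp) fun i => measurable_pi_apply i
  let ext : (Finset.range t → unitInterval) → ℕ → unitInterval :=
    fun y s => if h : s ∈ Finset.range t then y ⟨s, h⟩ else 0
  have hext : Measurable ext := by
    refine measurable_pi_iff.2 fun s => ?_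
    by_cases h : s ∈ Finset.range t
    · simpa only [ext, h, dite_true] using measurable_pi_apply _
    · simpa only [ext, h, dite_false] using measurable_const
  have hφ : Measurable fun y => alg.history P (u, ext y) t :=
    (alg.measurable_history P t).comp (measurable_const.prodMk hext)
  have hψ : Measurable fun y : ({t} : Finset ℕ) → unitInterval => y ⟨t, by simp⟩ :=
    measurable_pi_apply _
  have h2 := this.comp hφ hψ
  have he : (fun x : ℕ → unitInterval => alg.history P (u, x) t) =
      (fun y => alg.history P (u, ext y) t) ∘ fun x (s : Finset.range t) => x s :=
    funext fun x => alg.history_congr P u fun s hs => by simp [ext, hs]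
  rw [he]
  exact h2

/-- A real function of the seed and the history that can be integrated against the history of any
fixed number of rounds: measurable in the seed, and bounded in the seed for every history. -/
structure IsObservable {S : Type*} [MeasurableSpace S] (F : S → History n → ℝ) : Prop where
  measurable : ∀ h, Measurable fun u => F u h
  bounded : ∀ h, ∃ C, ∀ u, |F u h| ≤ C

lemma isObservable_of_history {S : Type*} [MeasurableSpace S] (f : History n → ℝ) :
    IsObservable fun _ : S => f :=
  ⟨fun _ => measurable_const, fun h => ⟨|f h|, fun _ => le_rfl⟩⟩

namespace IsObservable

variable {S : Type*} [MeasurableSpace S] {F G : S → History n → ℝ}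

lemma add (hF : IsObservable F) (hG : IsObservable G) : IsObservable fun u h => F u h + G u h := by
  refine ⟨fun h => (hF.measurable h).add (hG.measurable h), fun h => ?_⟩
  obtain ⟨C, hC⟩ := hF.bounded h
  obtain ⟨D, hD⟩ := hG.bounded h
  exact ⟨C + D, fun u => (abs_add_le _ _).trans (add_le_add (hC u) (hD u))⟩

lemma mul (hF : IsObservable F) (hG : IsObservable G) : IsObservable fun u h => F u h * G u h := by
  refine ⟨fun h => (hF.measurable h).mul (hG.measurable h), fun h => ?_⟩
  obtain ⟨C, hC⟩ := hF.bounded h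
  obtain ⟨D, hD⟩ := hG.bounded h
  refine ⟨C * D, fun u => ?_⟩
  rw [abs_mul]
  exact mul_le_mul (hC u) (hD u) (abs_nonneg _) ((abs_nonneg _).trans (hC u))

variable {alg P}

protected lemma nextMean {F : alg.Seed → History n → ℝ} (hF : IsObservable F) :
    IsObservable fun u h => nextMean P (alg.act u h) (F u) h := by
  refine ⟨fun h => ?_, fun h => ?_⟩
  · have h1 : Measurable fun p : alg.Seed × DuelingAction n => nextMean P p.2 (F p.1) h := by
      refine measurable_from_prod_countable_left fun a => ?_
      rcases a with ⟨i, j⟩ | b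
      · exact ((hF.measurable _).const_mul _).add ((hF.measurable _).const_mul _)
      · exact hF.measurable h
    exact h1.comp (measurable_id.prodMk (alg.measurable_act h))
  · have h1 : ∀ a : DuelingAction n, ∃ C, ∀ u, |nextMean P a (F u) h| ≤ C := by
      rintro (⟨i, j⟩ | b)
      · obtain ⟨C, hC⟩ := hF.bounded (h ++ [(i, j, true)])
        obtain ⟨D, hD⟩ := hF.bounded (h ++ [(i, j, false)])
        refine ⟨|P i j| * C + |1 - P i j| * D, fun u => (abs_add_le _ _).trans ?_⟩
        rw [abs_mul, abs_mul]
        gcongr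
        · exact hC u
        · exact hD u
      · exact hF.bounded h
    choose C hC using h1
    let e : (Fin n × Fin n) ⊕ Fin n → ℝ :=
      Sum.elim (fun p => C (.duel p.1 p.2)) fun b => C (.declare b)
    obtain ⟨M, hM⟩ := (Set.finite_range e).bddAbove
    refine ⟨M, fun u => ?_⟩
    rcases ha : alg.act u h with ⟨i, j⟩ | b
    · exact (hC _ u).trans (hM ⟨.inl (i, j), rfl⟩)
    · exact (hC _ u).trans (hM ⟨.inr b, rfl⟩)

lemma integrable {F : alg.Seed → History n → ℝ} (hF : IsObservable F)
    (P : Matrix (Fin n) (Fin n) ℝ) (t : ℕ) (μ : Measure alg.Sample) [IsFiniteMeasure μ] :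
    Integrable (fun ω => F ω.1 (alg.history P ω t)) μ := by
  choose C hC using hF.bounded
  obtain ⟨M, hM⟩ := ((List.finite_length_le (Fin n × Fin n × Bool) t).image C).bddAbove
  have h1 : Measurable fun p : alg.Seed × History n => F p.1 p.2 :=
    measurable_from_prod_countable_left hF.measurable
  refine Integrable.of_bound
    (h1.comp (measurable_fst.prodMk (alg.measurable_history P t))).aestronglyMeasurable M
    (Filter.Eventually.of_forall fun ω => ?_)
  exact (hC _ ω.1).trans (hM ⟨_, alg.length_history_le P ω t, rfl⟩)

end IsObservable

/-- The Markov property of the history. -/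
lemma integral_history_succ {P : Matrix (Fin n) (Fin n) ℝ} (hP : IsPreferenceMatrix P)
    {F : alg.Seed → History n → ℝ} (hF : IsObservable F) (t : ℕ) :
    ∫ ω, F ω.1 (alg.history P ω (t + 1)) ∂alg.law =
      ∫ ω, nextMean P (alg.act ω.1 (alg.history P ω t)) (F ω.1) (alg.history P ω t) ∂alg.law := by
  have i1 := hF.integrable P (t + 1) alg.law
  have i2 := (hF.nextMean (P := P)).integrable P t alg.law
  unfold law at i1 i2 ⊢
  rw [integral_prod _ i1, integral_prod _ i2]
  refine integral_congr_ae (Filter.Eventually.of_forall fun u => ?_)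
  set μ := Measure.infinitePi fun _ : ℕ => (volume : Measure unitInterval)
  have hX : Measurable fun x : ℕ → unitInterval => alg.history P (u, x) t :=
    (alg.measurable_history P t).comp measurable_prodMk_left
  have hY : Measurable fun x : ℕ → unitInterval => x t := measurable_pi_apply t
  have hmap := (indepFun_iff_map_prod_eq_prod_map_map hX.aemeasurable hY.aemeasurable).1
    (alg.indepFun_history P u t)
  have hYmap : μ.map (fun x => x t) = volume :=
    (measurePreserving_eval_infinitePi (fun _ : ℕ => (volume : Measure unitInterval)) t).map_eq
  rw [hYmap] at hmap
  -- the next observable as a function of the history and of the independent number of the round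
  let Ψ : History n × unitInterval → ℝ := fun q => F u (next P (alg.act u q.1) q.1 q.2)
  have hΨ : Measurable Ψ := measurable_from_prod_countable_right fun h =>
    (Measurable.of_discrete (f := F u)).comp (measurable_next P (alg.act u h) h)
  have hΨi : Integrable Ψ ((μ.map fun x => alg.history P (u, x) t).prod volume) := by
    rw [← hmap, integrable_map_measure hΨ.aestronglyMeasurable (hX.prodMk hY).aemeasurable]
    obtain ⟨M, hM⟩ := ((List.finite_length_le (Fin n × Fin n × Bool) (t + 1)).image
      fun h => |F u h|).bddAbove
    refine Integrable.of_bound (hΨ.comp (hX.prodMk hY)).aestronglyMeasurable M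
      (Filter.Eventually.of_forall fun x => hM ⟨_, ?_, rfl⟩)
    simpa only [history_succ, Set.mem_ofPred_eq] using alg.length_history_le P (u, x) (t + 1)
  calc ∫ x, F u (alg.history P (u, x) (t + 1)) ∂μ
      = ∫ x, Ψ (alg.history P (u, x) t, x t) ∂μ := by simp only [history_succ, Ψ]
    _ = ∫ q, Ψ q ∂((μ.map fun x => alg.history P (u, x) t).prod volume) := by
      rw [← hmap, integral_map (hX.prodMk hY).aemeasurable hΨ.aestronglyMeasurable]
    _ = ∫ h, (∫ z, Ψ (h, z)) ∂(μ.map fun x => alg.history P (u, x) t) := integral_prod _ hΨi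
    _ = ∫ h, nextMean P (alg.act u h) (F u) h ∂(μ.map fun x => alg.history P (u, x) t) := by
      simp only [Ψ, integral_next hP]
    _ = _ := integral_map hX.aemeasurable Measurable.of_discrete.aestronglyMeasurable

end DuelingAlgorithm

/-! ### Likelihood ratios and change of measure -/

namespace DuelingAlgorithm

variable {n : ℕ}

/-- The logarithm of the likelihood ratio, of `Q` against `P`, of the outcomes recorded in a
history. -/
noncomputable def logLikelihoodRatio (P Q : Matrix (Fin n) (Fin n) ℝ) (h : History n) : ℝ :=
  (h.map fun d => if d.2.2 then Real.log (Q d.1 d.2.1 / P d.1 d.2.1)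
    else Real.log ((1 - Q d.1 d.2.1) / (1 - P d.1 d.2.1))).sum

/-- The `χ²`-divergence of the Bernoulli laws of a duel between `a` and `b` under `P` and
under `Q`. -/
noncomputable def chiSq (P Q : Matrix (Fin n) (Fin n) ℝ) (a b : Fin n) : ℝ :=
  (P a b - Q a b) ^ 2 / (Q a b * (1 - Q a b))

/-- The `χ²`-divergences of the duels of a history, added up. -/
noncomputable def totalChiSq (P Q : Matrix (Fin n) (Fin n) ℝ) (h : History n) : ℝ :=
  (h.map fun d => chiSq P Q d.1 d.2.1).sum

/-- No duel has a certain outcome. -/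
def HasInteriorEntries (P : Matrix (Fin n) (Fin n) ℝ) : Prop :=
  ∀ i j, 0 < P i j ∧ P i j < 1

variable {P Q : Matrix (Fin n) (Fin n) ℝ}

lemma nextMean_mul_exp (hP : HasInteriorEntries P) (hQ : HasInteriorEntries Q)
    (a : DuelingAction n) (G : History n → ℝ) (h : History n) :
    nextMean P a (fun h => G h * Real.exp (logLikelihoodRatio P Q h)) h =
      nextMean Q a G h * Real.exp (logLikelihoodRatio P Q h) := by
  rcases a with ⟨i, j⟩ | b
  · obtain ⟨p0, p1⟩ := hP i j
    obtain ⟨q0, q1⟩ := hQ i j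
    have p2 : 0 < 1 - P i j := by linarith
    have q2 : 0 < 1 - Q i j := by linarith
    simp only [nextMean, logLikelihoodRatio, List.map_append, List.sum_append, List.map_cons,
      List.map_nil, List.sum_cons, List.sum_nil, if_true, Bool.false_eq_true, if_false, add_zero,
      Real.exp_add, Real.exp_log (div_pos q0 p0), Real.exp_log (div_pos q2 p2)]
    field_simp
  · rfl

/-- In one round the log-likelihood ratio drops by the Kullback–Leibler divergence on average, which
the `χ²`-divergence dominates. -/
lemma le_nextMean_logLikelihoodRatio (hP : HasInteriorEntries P) (hQ : HasInteriorEntries Q)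
    (a : DuelingAction n) (h : History n) :
    logLikelihoodRatio P Q h + totalChiSq P Q h ≤
      nextMean P a (fun h => logLikelihoodRatio P Q h + totalChiSq P Q h) h := by
  rcases a with ⟨i, j⟩ | b
  · obtain ⟨p0, p1⟩ := hP i j
    obtain ⟨q0, q1⟩ := hQ i j
    have p2 : 0 < 1 - P i j := by linarith
    have q2 : 0 < 1 - Q i j := by linarith
    simp only [nextMean, logLikelihoodRatio, totalChiSq, chiSq, List.map_append, List.sum_append,
      List.map_cons, List.map_nil, List.sum_cons, List.sum_nil, if_true, Bool.false_eq_true,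
      if_false, add_zero]
    have h1 : 1 - P i j / Q i j ≤ Real.log (Q i j / P i j) := by
      simpa [inv_div] using Real.one_sub_inv_le_log_of_pos (div_pos q0 p0)
    have h2 : 1 - (1 - P i j) / (1 - Q i j) ≤ Real.log ((1 - Q i j) / (1 - P i j)) := by
      simpa [inv_div] using Real.one_sub_inv_le_log_of_pos (div_pos q2 p2)
    have h3 := mul_le_mul_of_nonneg_left h1 p0.le
    have h4 := mul_le_mul_of_nonneg_left h2 p2.le
    have h5 : P i j * (1 - P i j / Q i j) + (1 - P i j) * (1 - (1 - P i j) / (1 - Q i j)) +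
        (P i j - Q i j) ^ 2 / (Q i j * (1 - Q i j)) = 0 := by
      field_simp
      ring
    linarith
  · exact le_rfl

variable (alg : DuelingAlgorithm n)

/-- Change of measure from `Q` to `P`. -/
lemma integral_history_eq_integral_mul_exp (hP : IsPreferenceMatrix P) (hQ : IsPreferenceMatrix Q)
    (hP' : HasInteriorEntries P) (hQ' : HasInteriorEntries Q) (t : ℕ)
    {F : alg.Seed → History n → ℝ} (hF : IsObservable F) :
    ∫ ω, F ω.1 (alg.history Q ω t) ∂alg.law =
      ∫ ω, F ω.1 (alg.history P ω t) *
        Real.exp (logLikelihoodRatio P Q (alg.history P ω t)) ∂alg.law := by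
  induction t generalizing F with
  | zero => simp [history, logLikelihoodRatio]
  | succ t ih =>
    rw [alg.integral_history_succ hQ hF, ih hF.nextMean, alg.integral_history_succ hP
      (F := fun u h => F u h * Real.exp (logLikelihoodRatio P Q h))
      (hF.mul (isObservable_of_history _))]
    simp only [nextMean_mul_exp hP' hQ']

lemma integral_logLikelihoodRatio_add_nonneg (hP : IsPreferenceMatrix P)
    (hP' : HasInteriorEntries P) (hQ' : HasInteriorEntries Q) (t : ℕ) :
    0 ≤ ∫ ω, (logLikelihoodRatio P Q (alg.history P ω t) +
      totalChiSq P Q (alg.history P ω t)) ∂alg.law := by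
  have hO : IsObservable fun (_ : alg.Seed) (h : History n) =>
    logLikelihoodRatio P Q h + totalChiSq P Q h := isObservable_of_history _
  induction t with
  | zero => simp [history, logLikelihoodRatio, totalChiSq]
  | succ t ih =>
    rw [alg.integral_history_succ hP hO]
    exact ih.trans (integral_mono (hO.integrable P t alg.law) (hO.nextMean.integrable P t alg.law)
      fun ω => le_nextMean_logLikelihoodRatio hP' hQ' _ _)

/-! ### The transportation inequality -/

/-- The event that the algorithm declares arm `b` within the first `t` rounds. -/
def declaredBy (P : Matrix (Fin n) (Fin n) ℝ) (b : Fin n) (t : ℕ) : Set alg.Sample :=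
  {ω | alg.act ω.1 (alg.history P ω t) = .declare b}

lemma measurableSet_declaredBy (P : Matrix (Fin n) (Fin n) ℝ) (b : Fin n) (t : ℕ) :
    MeasurableSet (alg.declaredBy P b t) := by
  have h1 : Measurable fun p : alg.Seed × History n => alg.act p.1 p.2 :=
    measurable_from_prod_countable_left alg.measurable_act
  exact (h1.comp (measurable_fst.prodMk (alg.measurable_history P t)))
    (MeasurableSet.of_discrete (s := {.declare b}))

lemma monotone_declaredBy (P : Matrix (Fin n) (Fin n) ℝ) (b : Fin n) :
    Monotone (alg.declaredBy P b) := by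
  refine monotone_nat_of_le_succ fun t ω hω => ?_
  simp only [declaredBy, Set.mem_ofPred_eq] at hω ⊢
  rw [history_succ, hω]
  exact hω

lemma outputs_eq_iUnion (P : Matrix (Fin n) (Fin n) ℝ) (b : Fin n) :
    alg.outputs P b = ⋃ t, alg.declaredBy P b t := by
  ext ω
  simp [outputs, declaredBy]

lemma measurableSet_outputs (P : Matrix (Fin n) (Fin n) ℝ) (b : Fin n) :
    MeasurableSet (alg.outputs P b) := by
  rw [outputs_eq_iUnion]
  exact .iUnion fun t => alg.measurableSet_declaredBy P b t

lemma disjoint_outputs (P : Matrix (Fin n) (Fin n) ℝ) {b c : Fin n} (hbc : b ≠ c) :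
    Disjoint (alg.outputs P b) (alg.outputs P c) := by
  rw [Set.disjoint_left, outputs_eq_iUnion, outputs_eq_iUnion]
  intro ω hb hc
  obtain ⟨s, hs⟩ := Set.mem_iUnion.1 hb
  obtain ⟨t, ht⟩ := Set.mem_iUnion.1 hc
  have h1 := alg.monotone_declaredBy P b (le_max_left s t) hs
  have h2 := alg.monotone_declaredBy P c (le_max_right s t) ht
  rw [declaredBy, Set.mem_ofPred_eq] at h1 h2
  rw [h1] at h2
  exact hbc (DuelingAction.declare.inj h2)

/-- A transportation inequality: an event that is likely under `P` and unlikely under `Q` forces a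
large expected total divergence of the duels. It is the Donsker–Varadhan bound for the test function
`c • 1_A`, where `A` is the event that `b` has been declared after `t` rounds. -/
lemma mul_declaredBy_sub_le_log (hP : IsPreferenceMatrix P) (hQ : IsPreferenceMatrix Q)
    (hP' : HasInteriorEntries P) (hQ' : HasInteriorEntries Q) (b : Fin n) (t : ℕ)
    {c β : ℝ} (hc : 0 ≤ c) (hβ : 0 ≤ β) (hA : alg.law.real (alg.declaredBy Q b t) ≤ β) :
    c * alg.law.real (alg.declaredBy P b t) -
        ∫ ω, totalChiSq P Q (alg.history P ω t) ∂alg.law ≤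
      Real.log (1 + (Real.exp c - 1) * β) := by
  set D : alg.Seed → History n → ℝ := fun u h =>
    {u | alg.act u h = .declare b}.indicator (fun _ => 1) u with hD
  have hDO : IsObservable D :=
    ⟨fun h => measurable_const.indicator (alg.measurableSet_act h _), fun h => ⟨1, fun u => by
      by_cases hu : alg.act u h = .declare b <;> simp [hD, hu]⟩⟩
  have hconst : ∀ f : History n → ℝ, IsObservable fun _ : alg.Seed => f :=
    fun f => isObservable_of_history f
  have hint : ∀ R : Matrix (Fin n) (Fin n) ℝ,
      ∫ ω, D ω.1 (alg.history R ω t) ∂alg.law = alg.law.real (alg.declaredBy R b t) := fun R => by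
    rw [← integral_indicator_one (alg.measurableSet_declaredBy R b t)]
    rfl
  have hec : 0 ≤ Real.exp c - 1 := by linarith [Real.one_le_exp hc]
  set y := 1 + (Real.exp c - 1) * β with hy
  have hy0 : 0 < y := by positivity
  set L := logLikelihoodRatio P Q
  -- the expectation under `Q` of `exp (c • 1_A)`
  have hQexp : ∫ ω, (1 + (Real.exp c - 1) * D ω.1 (alg.history P ω t)) *
      Real.exp (L (alg.history P ω t)) ∂alg.law ≤ y := by
    have hO : IsObservable fun u h => 1 + (Real.exp c - 1) * D u h :=
      (hconst fun _ => 1).add ((hconst fun _ => Real.exp c - 1).mul hDO)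
    rw [← alg.integral_history_eq_integral_mul_exp hP hQ hP' hQ' t hO,
      integral_add (integrable_const _) ((hDO.integrable Q t alg.law).const_mul _),
      integral_const_mul, hint]
    simp only [integral_const, probReal_univ, smul_eq_mul, one_mul, hy]
    gcongr
  have hpt : ∀ ω : alg.Sample, c * D ω.1 (alg.history P ω t) + L (alg.history P ω t) ≤
      y⁻¹ * ((1 + (Real.exp c - 1) * D ω.1 (alg.history P ω t)) *
        Real.exp (L (alg.history P ω t))) + (Real.log y - 1) := fun ω => by
    have h1 : (1 + (Real.exp c - 1) * D ω.1 (alg.history P ω t)) *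
        Real.exp (L (alg.history P ω t)) =
        Real.exp (c * D ω.1 (alg.history P ω t) + L (alg.history P ω t)) := by
      rw [Real.exp_add]
      by_cases hu : alg.act ω.1 (alg.history P ω t) = .declare b <;> simp [hD, hu]
    rw [h1]
    -- `x ≤ exp x / y - 1 + log y`, with equality at `x = log y`
    have h2 := Real.add_one_le_exp
      (c * D ω.1 (alg.history P ω t) + L (alg.history P ω t) - Real.log y)
    rw [Real.exp_sub, Real.exp_log hy0, div_eq_inv_mul] at h2
    linarith
  have hLi := (hconst L).integrable P t alg.law
  have hDi := (hDO.integrable P t alg.law).const_mul c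
  have hEi := ((((hconst fun _ => 1).add ((hconst fun _ => Real.exp c - 1).mul hDO)).mul
    (hconst fun h => Real.exp (L h))).integrable P t alg.law).const_mul y⁻¹
  have hmono := integral_mono (hDi.add hLi) (hEi.add (integrable_const (Real.log y - 1))) hpt
  simp only [Pi.add_apply] at hmono
  rw [integral_add hDi hLi, integral_add hEi (integrable_const _), integral_const_mul,
    integral_const_mul, hint] at hmono
  simp only [integral_const, probReal_univ, smul_eq_mul, one_mul] at hmono
  have hnn := alg.integral_logLikelihoodRatio_add_nonneg hP hP' hQ' t
  rw [integral_add hLi ((hconst (totalChiSq P Q)).integrable P t alg.law)] at hnn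
  have hyy : y⁻¹ * ∫ ω, (1 + (Real.exp c - 1) * D ω.1 (alg.history P ω t)) *
      Real.exp (L (alg.history P ω t)) ∂alg.law ≤ 1 := by
    rw [inv_mul_le_iff₀ hy0]
    linarith
  linarith

/-! ### Telling `P` from several alternatives -/

lemma integral_length_history_le (P : Matrix (Fin n) (Fin n) ℝ) (hfin : alg.expectedDuels P ≠ ⊤)
    (t : ℕ) : ∫ ω, ((alg.history P ω t).length : ℝ) ∂alg.law ≤ (alg.expectedDuels P).toReal := by
  have hO : IsObservable fun (_ : alg.Seed) (h : History n) => (h.length : ℝ) :=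
    isObservable_of_history _
  rw [integral_eq_lintegral_of_nonneg_ae (.of_forall fun _ => Nat.cast_nonneg _)
    (hO.integrable P t alg.law).aestronglyMeasurable]
  refine ENNReal.toReal_mono hfin (lintegral_mono fun ω => ?_)
  simp only [ENNReal.ofReal_natCast]
  exact le_iSup (fun t : ℕ => ((alg.history P ω t).length : ENNReal)) t

/-- If the winner of every `Q i` differs from that of `P`, a `δ`-PAC algorithm has to tell `P` from
every `Q i`. When any single duel contributes at most `K` to the `v`-weighted sum of the divergences
from `P` to the `Q i`, this takes many duels. -/
theorem sum_mul_log_le_mul_expectedDuels {ι : Type*} (s : Finset ι) {δ : ℝ} (hδ0 : 0 < δ)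
    (hδ1 : δ < 1 / 2) (halg : alg.IsPAC δ) (hP : IsPreferenceMatrix P)
    (hP' : HasInteriorEntries P) {best : Fin n} (hbest : IsUniqueBordaWinner P best)
    (Q : ι → Matrix (Fin n) (Fin n) ℝ) (winner : ι → Fin n) (v : ι → ℝ) (K : ℝ)
    (hQ : ∀ i ∈ s, IsPreferenceMatrix (Q i)) (hQ' : ∀ i ∈ s, HasInteriorEntries (Q i))
    (hwinner : ∀ i ∈ s, IsUniqueBordaWinner (Q i) (winner i))
    (hne : ∀ i ∈ s, winner i ≠ best) (hv : ∀ i ∈ s, 0 ≤ v i)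
    (hK : ∀ a b, ∑ i ∈ s, v i * chiSq P (Q i) a b ≤ K) (hfin : alg.expectedDuels P ≠ ⊤) :
    (∑ i ∈ s, v i) * ((1 - 2 * δ) * Real.log ((1 - δ) / δ)) ≤
      K * (alg.expectedDuels P).toReal := by
  have hℓ0 : 0 ≤ Real.log ((1 - δ) / δ) := Real.log_nonneg (by rw [le_div_iff₀ hδ0]; linarith)
  have hδ2 : 0 < 1 - δ := by linarith
  -- the optimal tilt: `exp c = ((1 - δ) / δ) ^ 2`, so that `1 + (exp c - 1) * δ = (1 - δ) / δ`
  set c := 2 * Real.log ((1 - δ) / δ) with hc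
  have hexp : 1 + (Real.exp c - 1) * δ = (1 - δ) / δ := by
    rw [hc, two_mul, Real.exp_add, Real.exp_log (by positivity)]
    field_simp
    ring
  have hQle : ∀ i ∈ s, ∀ t, alg.law.real (alg.declaredBy (Q i) best t) ≤ δ := fun i hi t => by
    have h1 : alg.law.real (alg.declaredBy (Q i) best t) ≤ alg.law.real (alg.outputs (Q i) best) :=
      measureReal_mono (by rw [outputs_eq_iUnion]; exact Set.subset_iUnion _ t)
    have h2 := measureReal_union (μ := alg.law) (alg.disjoint_outputs (Q i) (hne i hi))
      (alg.measurableSet_outputs _ _)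
    have h3 : alg.law.real (alg.outputs (Q i) (winner i) ∪ alg.outputs (Q i) best) ≤ 1 :=
      measureReal_le_one
    have h4 := halg (Q i) (winner i) (hQ i hi) (hwinner i hi)
    linarith
  have hKsum : ∀ h : History n, ∑ i ∈ s, v i * totalChiSq P (Q i) h ≤ K * h.length := fun h => by
    induction h with
    | nil => simp [totalChiSq]
    | cons d h ih =>
      simp only [totalChiSq, List.map_cons, List.sum_cons, mul_add, Finset.sum_add_distrib,
        List.length_cons, Nat.cast_add, Nat.cast_one, mul_one] at ih ⊢
      linarith [hK d.1 d.2.1]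
  have hK0 : 0 ≤ K := by
    refine le_trans (Finset.sum_nonneg fun i hi => mul_nonneg (hv i hi) ?_) (hK best best)
    obtain ⟨q0, q1⟩ := hQ' i hi best best
    exact div_nonneg (sq_nonneg _) (mul_nonneg q0.le (by linarith))
  have hstep : ∀ t, (∑ i ∈ s, v i) * (c * alg.law.real (alg.declaredBy P best t) -
      Real.log ((1 - δ) / δ)) ≤ K * (alg.expectedDuels P).toReal := fun t => by
    have hi : ∀ f : History n → ℝ, Integrable (fun ω => f (alg.history P ω t)) alg.law :=
      fun f => (isObservable_of_history f).integrable P t alg.law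
    calc (∑ i ∈ s, v i) * (c * alg.law.real (alg.declaredBy P best t) - Real.log ((1 - δ) / δ))
        ≤ ∑ i ∈ s, v i * ∫ ω, totalChiSq P (Q i) (alg.history P ω t) ∂alg.law := by
          rw [Finset.sum_mul]
          refine Finset.sum_le_sum fun i hi => mul_le_mul_of_nonneg_left ?_ (hv i hi)
          have := alg.mul_declaredBy_sub_le_log hP (hQ i hi) hP' (hQ' i hi) best t
            (c := c) (by positivity) hδ0.le (hQle i hi t)
          rw [hexp] at this
          linarith
      _ = ∫ ω, ∑ i ∈ s, v i * totalChiSq P (Q i) (alg.history P ω t) ∂alg.law := by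
          rw [integral_finsetSum _ fun i _ => (hi _).const_mul _]
          simp only [integral_const_mul]
      _ ≤ ∫ ω, K * ((alg.history P ω t).length : ℝ) ∂alg.law :=
          integral_mono (hi fun h => ∑ i ∈ s, v i * totalChiSq P (Q i) h)
            (hi fun h => K * (h.length : ℝ)) fun ω => hKsum _
      _ ≤ K * (alg.expectedDuels P).toReal := by
          rw [integral_const_mul]
          exact mul_le_mul_of_nonneg_left (alg.integral_length_history_le P hfin t) hK0
  have hlim : Filter.Tendsto (fun t => alg.law.real (alg.declaredBy P best t)) Filter.atTop
      (nhds (alg.law.real (alg.outputs P best))) := by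
    rw [outputs_eq_iUnion]
    exact (ENNReal.tendsto_toReal (measure_ne_top _ _)).comp
      (tendsto_measure_iUnion_atTop (alg.monotone_declaredBy P best))
  have hle := le_of_tendsto' (((hlim.const_mul c).sub_const _).const_mul _) hstep
  refine le_trans (mul_le_mul_of_nonneg_left ?_ (Finset.sum_nonneg hv)) hle
  have := mul_le_mul_of_nonneg_left (halg P best hP hbest) (show 0 ≤ c by positivity)
  rw [hc] at this ⊢
  linarith

end DuelingAlgorithm

/-! ### The alternative preference matrices -/

variable {n : ℕ}

/-- The preference matrix in which arm `i` does better by `D` than under `P` against every arm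
except `best`. -/
def raiseArm (P : Matrix (Fin n) (Fin n) ℝ) (best i : Fin n) (D : ℝ) :
    Matrix (Fin n) (Fin n) ℝ := fun a b =>
  P a b + (if a = i ∧ b ≠ i ∧ b ≠ best then D else 0) - if b = i ∧ a ≠ i ∧ a ≠ best then D else 0

lemma bordaScore_raiseArm_self (P : Matrix (Fin n) (Fin n) ℝ) {best i : Fin n} (hi : i ≠ best)
    (D : ℝ) : bordaScore (raiseArm P best i D) i =
      bordaScore P i + ((n : ℝ) - 2) / ((n : ℝ) - 1) * D := by
  have h2 : 2 ≤ n := by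
    have := Fin.val_ne_of_ne hi
    omega
  have h1 : ∑ j ∈ Finset.univ.erase i, raiseArm P best i D i j =
      ∑ j ∈ Finset.univ.erase i, P i j + ((n : ℝ) - 2) * D := by
    have : ∀ j ∈ Finset.univ.erase i,
        raiseArm P best i D i j = P i j + if j ≠ best then D else 0 := fun j hj => by
      simp [raiseArm, Finset.ne_of_mem_erase hj]
    rw [Finset.sum_congr rfl this, Finset.sum_add_distrib, ← Finset.sum_filter,
      Finset.filter_ne', Finset.sum_const, Finset.card_erase_of_mem
      (Finset.mem_erase.2 ⟨hi.symm, Finset.mem_univ _⟩), Finset.card_erase_of_mem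
      (Finset.mem_univ _), Finset.card_univ, Fintype.card_fin, nsmul_eq_mul, Nat.sub_sub,
      Nat.cast_sub h2]
    norm_num
  rw [bordaScore, bordaScore, h1]
  ring

lemma bordaScore_raiseArm_best (P : Matrix (Fin n) (Fin n) ℝ) {best i : Fin n} (hi : i ≠ best)
    (D : ℝ) : bordaScore (raiseArm P best i D) best = bordaScore P best := by
  simp [bordaScore, raiseArm, hi.symm]

lemma bordaScore_raiseArm_le (P : Matrix (Fin n) (Fin n) ℝ) {best i k : Fin n} (hk : k ≠ i)
    {D : ℝ} (hD : 0 ≤ D) : bordaScore (raiseArm P best i D) k ≤ bordaScore P k := by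
  have h1 : 1 ≤ (n : ℝ) := by exact_mod_cast k.pos
  refine mul_le_mul_of_nonneg_left (Finset.sum_le_sum fun j _ => ?_)
    (one_div_nonneg.2 (by linarith))
  simp only [raiseArm, hk, false_and, if_false, add_zero]
  split_ifs <;> linarith

/-- The raise that lets arm `i` overtake arm `best`; anything above `(n - 1) / (n - 2)` times the
gap of the scores will do. The factor `101 / 100` is small enough for the raised entries to stay well
below `1`. -/
noncomputable def overtakingRaise (P : Matrix (Fin n) (Fin n) ℝ) (best i : Fin n) : ℝ :=
  101 / 100 * (((n : ℝ) - 1) / ((n : ℝ) - 2) * (bordaScore P best - bordaScore P i))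

variable {P : Matrix (Fin n) (Fin n) ℝ} {best : Fin n}

lemma overtakingRaise_pos (hn : 3 ≤ n) (hbest : IsUniqueBordaWinner P best) {i : Fin n}
    (hi : i ≠ best) : 0 < overtakingRaise P best i := by
  have h3 : (3 : ℝ) ≤ n := by exact_mod_cast hn
  have := hbest i hi
  exact mul_pos (by norm_num) (mul_pos (div_pos (by linarith) (by linarith)) (by linarith))

lemma isUniqueBordaWinner_raiseArm (hn : 3 ≤ n) (hbest : IsUniqueBordaWinner P best) {i : Fin n}
    (hi : i ≠ best) :
    IsUniqueBordaWinner (raiseArm P best i (overtakingRaise P best i)) i := by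
  have h3 : (3 : ℝ) ≤ n := by exact_mod_cast hn
  have hg := hbest i hi
  have h1 : (n : ℝ) - 1 ≠ 0 := by linarith
  have h2 : (n : ℝ) - 2 ≠ 0 := by linarith
  have hwin : bordaScore P best <
      bordaScore (raiseArm P best i (overtakingRaise P best i)) i := by
    rw [bordaScore_raiseArm_self P hi, overtakingRaise]
    have : ((n : ℝ) - 2) / ((n : ℝ) - 1) * (101 / 100 * (((n : ℝ) - 1) / ((n : ℝ) - 2) *
        (bordaScore P best - bordaScore P i))) =
        101 / 100 * (bordaScore P best - bordaScore P i) := by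
      field_simp
    rw [this]
    linarith
  intro k hk
  have hk' := bordaScore_raiseArm_le P (best := best) hk (overtakingRaise_pos hn hbest hi).le
  by_cases hkb : k = best
  · rw [hkb] at hk' ⊢
    linarith
  · linarith [hbest k hkb]

/-- A raised entry stays well below `1`. Entry by entry this is not clear, since for `n = 3` the raise
can be close to `1 / 2`; but a large `P i j` also increases the score of `i`, hence makes the raise
smaller. -/
lemma add_overtakingRaise_le (hn : 3 ≤ n) (hP : ∀ i j, 3 / 8 ≤ P i j ∧ P i j ≤ 5 / 8)
    {i j : Fin n} (hij : j ≠ i) : P i j + overtakingRaise P best i ≤ 22 / 25 := by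
  have h3 : (3 : ℝ) ≤ n := by exact_mod_cast hn
  have h1 : 0 < (n : ℝ) - 1 := by linarith
  have h2 : 0 < (n : ℝ) - 2 := by linarith
  have hSb : ∑ k ∈ Finset.univ.erase best, P best k ≤ ((n : ℝ) - 1) * (5 / 8) := by
    refine (Finset.sum_le_card_nsmul _ _ (5 / 8) fun k _ => (hP best k).2).trans_eq ?_
    rw [Finset.card_erase_of_mem (Finset.mem_univ _), Finset.card_univ, Fintype.card_fin,
      nsmul_eq_mul, Nat.cast_sub (by omega)]
    norm_num
  have hSi : P i j + ((n : ℝ) - 2) * (3 / 8) ≤ ∑ k ∈ Finset.univ.erase i, P i k := by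
    have hj : j ∈ Finset.univ.erase i := Finset.mem_erase.2 ⟨hij, Finset.mem_univ _⟩
    rw [← Finset.add_sum_erase _ _ hj]
    gcongr
    refine Eq.trans_le ?_ (Finset.card_nsmul_le_sum _ _ (3 / 8) fun k _ => (hP i k).1)
    rw [Finset.card_erase_of_mem hj, Finset.card_erase_of_mem (Finset.mem_univ _),
      Finset.card_univ, Fintype.card_fin, nsmul_eq_mul, Nat.sub_sub, Nat.cast_sub (by omega)]
    norm_num
  have hR : overtakingRaise P best i = 101 / 100 * (∑ k ∈ Finset.univ.erase best, P best k -
      ∑ k ∈ Finset.univ.erase i, P i k) / ((n : ℝ) - 2) := by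
    rw [overtakingRaise, bordaScore, bordaScore]
    field_simp
  have hp := hP i j
  rw [hR, ← le_sub_iff_add_le', div_le_iff₀ h2]
  nlinarith [mul_nonneg (sub_nonneg.2 h3) (sub_nonneg.2 hp.2)]

lemma raiseArm_overtakingRaise_mem (hn : 3 ≤ n) (hP : IsPreferenceMatrix P)
    (hP' : ∀ i j, 3 / 8 ≤ P i j ∧ P i j ≤ 5 / 8) (hbest : IsUniqueBordaWinner P best)
    {i : Fin n} (hi : i ≠ best) (a b : Fin n) :
    3 / 25 ≤ raiseArm P best i (overtakingRaise P best i) a b ∧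
      raiseArm P best i (overtakingRaise P best i) a b ≤ 22 / 25 := by
  have hD := overtakingRaise_pos hn hbest hi
  have hab := hP' a b
  have hs := hP.add_swap a b
  unfold raiseArm
  split_ifs with h1 h2 h2
  · exact absurd h2.1 h1.2.1
  · obtain ⟨rfl, hb, -⟩ := h1
    have := add_overtakingRaise_le (best := best) hn hP' hb
    constructor <;> linarith
  · obtain ⟨rfl, ha, -⟩ := h2
    have := add_overtakingRaise_le (best := best) hn hP' ha
    constructor <;> linarith
  · constructor <;> linarith

lemma raiseArm_add_swap (hP : IsPreferenceMatrix P) (best i : Fin n) (D : ℝ) (a b : Fin n) :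
    raiseArm P best i D a b + raiseArm P best i D b a = 1 := by
  unfold raiseArm
  linarith [hP.add_swap a b]

lemma chiSq_raiseArm_le {i a b : Fin n} {D : ℝ}
    (h0 : 3 / 25 ≤ raiseArm P best i D a b) (h1 : raiseArm P best i D a b ≤ 22 / 25) :
    DuelingAlgorithm.chiSq P (raiseArm P best i D) a b ≤
      10 * D ^ 2 * ((if i = a then 1 else 0) + if i = b then 1 else 0) := by
  have hq : 1 / 10 ≤ raiseArm P best i D a b * (1 - raiseArm P best i D a b) := by
    nlinarith [mul_nonneg (sub_nonneg.2 h0) (sub_nonneg.2 h1)]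
  have h2 : (P a b - raiseArm P best i D a b) ^ 2 ≤
      D ^ 2 * ((if i = a then 1 else 0) + if i = b then 1 else 0) := by
    have hD := sq_nonneg D
    simp only [raiseArm, eq_comm (a := i)]
    by_cases ha : a = i <;> by_cases hb : b = i <;>
      simp only [ha, hb, true_and, false_and, and_false, ne_eq, not_true_eq_false,
        not_false_eq_true, if_true, if_false] <;> (try split_ifs) <;> ring_nf <;> linarith
  rw [DuelingAlgorithm.chiSq, div_le_iff₀ (by linarith)]
  nlinarith [mul_le_mul_of_nonneg_left hq ((sq_nonneg _).trans h2)]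

/-! ### The lower bound -/

theorem theorem1 {n : ℕ} (hn : 3 ≤ n) (P : Matrix (Fin n) (Fin n) ℝ) (hP : IsPreferenceMatrix P)
    (hP_entries : ∀ i j, 3 / 8 ≤ P i j ∧ P i j ≤ 5 / 8)
    (best : Fin n) (hbest : IsUniqueBordaWinner P best)
    (δ : ℝ) (hδ_pos : 0 < δ) (hδ : δ ≤ 0.15)
    (alg : DuelingAlgorithm n) (halg : alg.IsPAC δ) :
    (4 ≤ n →
      ENNReal.ofReal ((1 / 90) * Real.log (1 / (2 * δ)) *
          ∑ i ∈ Finset.univ.erase best, 1 / (bordaScore P best - bordaScore P i) ^ 2)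
        ≤ alg.expectedDuels P) ∧
    ENNReal.ofReal ((1 / 40) * (((n : ℝ) - 2) / ((n : ℝ) - 1)) ^ 2 *
          (∑ i ∈ Finset.univ.erase best, 1 / (bordaScore P best - bordaScore P i) ^ 2) *
          Real.log (1 / (2 * δ)))
        ≤ alg.expectedDuels P := by
  have h3 : (3 : ℝ) ≤ n := by exact_mod_cast hn
  have hn1 : 0 < (n : ℝ) - 1 := by linarith
  have hn2 : 0 < (n : ℝ) - 2 := by linarith
  norm_num at hδ
  set S := ∑ i ∈ Finset.univ.erase best, 1 / (bordaScore P best - bordaScore P i) ^ 2 with hS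
  have hS0 : 0 ≤ S := Finset.sum_nonneg fun i _ => by positivity
  have hlog : 0 ≤ Real.log (1 / (2 * δ)) :=
    Real.log_nonneg (by rw [le_div_iff₀ (by positivity)]; linarith)
  have hmain : ENNReal.ofReal ((1 / 40) * (((n : ℝ) - 2) / ((n : ℝ) - 1)) ^ 2 * S *
      Real.log (1 / (2 * δ))) ≤ alg.expectedDuels P := by
    by_cases hfin : alg.expectedDuels P = ⊤
    · rw [hfin]
      exact le_top
    rw [← ENNReal.ofReal_toReal hfin]
    refine ENNReal.ofReal_le_ofReal ?_
    set D := overtakingRaise P best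
    have hmem : ∀ i ∈ Finset.univ.erase best, i ≠ best := fun i hi => Finset.ne_of_mem_erase hi
    have hent := fun i (hi : i ∈ Finset.univ.erase best) =>
      raiseArm_overtakingRaise_mem hn hP hP_entries hbest (hmem i hi)
    have key := alg.sum_mul_log_le_mul_expectedDuels (Finset.univ.erase best) hδ_pos
      (by linarith) halg hP (fun i j => ⟨by linarith [(hP_entries i j).1],
        by linarith [(hP_entries i j).2]⟩) hbest (fun i => raiseArm P best i (D i)) (fun i => i)
      (fun i => 1 / D i ^ 2) 20
      (fun i hi => ⟨fun a b => by linarith [(hent i hi a b).1],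
        fun a b => by linarith [(hent i hi a b).2], raiseArm_add_swap hP best i (D i)⟩)
      (fun i hi a b => ⟨by linarith [(hent i hi a b).1], by linarith [(hent i hi a b).2]⟩)
      (fun i hi => isUniqueBordaWinner_raiseArm hn hbest (hmem i hi)) hmem
      (fun i _ => by positivity) (fun a b => ?_) hfin
    · have hsum : ∑ i ∈ Finset.univ.erase best, 1 / D i ^ 2 =
          (100 / 101) ^ 2 * (((n : ℝ) - 2) / ((n : ℝ) - 1)) ^ 2 * S := by
        rw [hS, Finset.mul_sum]
        refine Finset.sum_congr rfl fun i hi => ?_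
        have := sub_pos.2 (hbest i (hmem i hi))
        simp only [D, overtakingRaise]
        field_simp
      have hlog2 : Real.log (1 / (2 * δ)) ≤ Real.log ((1 - δ) / δ) := by
        refine Real.log_le_log (by positivity) ?_
        rw [div_le_div_iff₀ (by positivity) hδ_pos]
        nlinarith
      have hkl : 7 / 10 * Real.log (1 / (2 * δ)) ≤ (1 - 2 * δ) * Real.log ((1 - δ) / δ) :=
        mul_le_mul (by linarith) hlog2 hlog (by linarith)
      rw [hsum] at key
      set M := (((n : ℝ) - 2) / ((n : ℝ) - 1)) ^ 2 * S with hM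
      have hM0 : 0 ≤ M := by positivity
      have h4 := mul_le_mul_of_nonneg_left hkl hM0
      have h5 := mul_nonneg hM0 hlog
      nlinarith
    · -- a duel of `a` and `b` only helps to rule out the matrices that raise arm `a` or arm `b`
      calc ∑ i ∈ Finset.univ.erase best,
            1 / D i ^ 2 * DuelingAlgorithm.chiSq P (raiseArm P best i (D i)) a b
          ≤ ∑ i ∈ Finset.univ.erase best,
            10 * ((if i = a then 1 else 0) + if i = b then 1 else 0 : ℝ) := by
            refine Finset.sum_le_sum fun i hi => ?_
            have hD : 0 < D i := overtakingRaise_pos hn hbest (hmem i hi)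
            have := chiSq_raiseArm_le (hent i hi a b).1 (hent i hi a b).2
            rw [div_mul_eq_mul_div, one_mul, div_le_iff₀ (by positivity)]
            linarith
        _ ≤ ∑ i, 10 * ((if i = a then 1 else 0) + if i = b then 1 else 0 : ℝ) :=
            Finset.sum_le_sum_of_subset_of_nonneg (Finset.erase_subset _ _)
              fun i _ _ => by positivity
        _ = 20 := by
            rw [← Finset.mul_sum, Finset.sum_add_distrib]
            norm_num
  refine ⟨fun h4 => le_trans (ENNReal.ofReal_le_ofReal ?_) hmain, hmain⟩
  have h4' : (4 : ℝ) ≤ n := by exact_mod_cast h4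
  have hr : 2 / 3 ≤ ((n : ℝ) - 2) / ((n : ℝ) - 1) := by
    rw [div_le_div_iff₀ (by norm_num) hn1]
    linarith
  have hr2 : (2 / 3) ^ 2 ≤ (((n : ℝ) - 2) / ((n : ℝ) - 1)) ^ 2 := by gcongr
  have := mul_le_mul_of_nonneg_right hr2 (mul_nonneg hS0 hlog)
  linarith
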